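/- Let $\mathrm{FI}$ be the category of finite sets and injections. An FI-module is a functor $W\colon \mathrm{FI}\to \mathbb{Z}\text{-Mod}$, $T\mapsto W_T$; put $W_n:=W_{\{1,\dots,n\}}$. Its degree $\deg W\in\{-\infty\}\cup\mathbb{N}\cup\{\infty\}$ is the least $k$ such that $W_n=0$ for all $n\in\mathbb{N}$ with $n>k$. Let $H_0\colon \mathrm{FI}\text{-Mod}\to\mathrm{FI}\text{-Mod}$ be the right exact functor $$H_0(W)_T = W_T\,/\,\operatorname{span}\bigl(\operatorname{im}(f_*\colon W_S\to W_T)\ \big|\ f\colon S\hookrightarrow T,\ |S|<|T|\bigr),$$ and let $H_1$ be its first left derived functor. **Theorem.** Let $W$ be an arbitrary FI-module and let $N:=\max\bigl(\deg H_0(W),\deg H_1(W)\bigr)\in\{-\infty\}\cup\mathbb{N}\cup\{\infty\}$. Then for every finite set $T$, $$W_T=\operatorname*{colim}_{S\subset T,\ |S|\le N} W_S,$$ that is, the maps $W_S\to W_T$ induced by the inclusions $S\subset T$ exhibit $W_T$ as the colimit of the groups $W_S$ over the poset, under inclusion, of the subsets $S\subset T$ with $|S|\le N$. Moreover, $N$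 is the smallest element of $\{-\infty\}\cup\mathbb{N}\cup\{\infty\}$ with this property: if $K\in\{-\infty\}\cup\mathbb{N}\cup\{\infty\}$ is such that for every finite set $T$ the maps $W_S\to W_T$ exhibit $W_T$ as the colimit of the $W_S$ over the subsets $S\subset T$ with $|S|\le K$, then $N\le K$. -/

import Mathlib

open CategoryTheory CategoryTheory.Limits

universe u v

/-- Objects of the category `FI`: finite sets. -/
structure FI : Type (u + 1) where
  carrier : Type u
  [finite : Finite carrier]

namespace FI

attribute [instance] FI.finite

/-- Morphisms of `FI`: injections. -/
instance : Category.{u} FI.{u} where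
  Hom S T := S.carrier ↪ T.carrier
  id S := Function.Embedding.refl S.carrier
  comp f g := Function.Embedding.trans f g

instance (S T : FI.{u}) : Finite (S ⟶ T) :=
  inferInstanceAs (Finite (S.carrier ↪ T.carrier))

/-- The number of elements of a finite set. -/
noncomputable def card (T : FI.{u}) : ℕ := Nat.card T.carrier

/-- The finite set with `n` elements `0, …, n - 1`. -/
def std (n : ℕ) : FI.{u} := ⟨ULift.{u} (Fin n)⟩

lemma card_le_of_hom {S T : FI.{u}} (f : S ⟶ T) : S.card ≤ T.card :=
  Nat.card_le_card_of_injective _ (Function.Embedding.injective f)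

/-- Every finite set is isomorphic to a standard one. -/
lemma nonempty_iso_std (T : FI.{u}) : Nonempty (std.{u} T.card ≅ T) := by
  let e : ULift.{u} (Fin T.card) ≃ T.carrier :=
    Equiv.ulift.trans (Finite.equivFin T.carrier).symm
  refine ⟨⟨e.toEmbedding, e.symm.toEmbedding, ?_, ?_⟩⟩
  · exact Function.Embedding.ext fun x => e.symm_apply_apply x
  · exact Function.Embedding.ext fun x => e.apply_symm_apply x

end FI

set_option linter.checkUnivs false in
/-- `FI`-modules: functors from `FI` to abelian groups. -/
abbrev FIMod := FI.{u} ⥤ ModuleCat.{v} ℤ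

namespace FIMod

/-- The degree of an `FI`-module, an element of `{-∞} ∪ ℕ ∪ {∞}`. -/
noncomputable def deg (W : FIMod.{u, v}) : WithBot ℕ∞ :=
  sInf {k : WithBot ℕ∞ | ∀ n : ℕ, k < (n : WithBot ℕ∞) → IsZero (W.obj (FI.std n))}

/-- The span in `W_T` of the images of all maps `W_S → W_T` induced by injections `S → T`
with `|S| < |T|`. -/
def decomposables (W : FIMod.{u, v}) (T : FI.{u}) : Submodule ℤ (W.obj T) :=
  ⨆ (S : FI.{u}) (f : S ⟶ T) (_ : S.card < T.card), LinearMap.range (W.map f).hom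

lemma decomposables_le_comap_map (W : FIMod.{u, v}) {T T' : FI.{u}} (g : T ⟶ T') :
    W.decomposables T ≤ (W.decomposables T').comap (W.map g).hom := by
  refine iSup_le fun S => iSup_le fun f => iSup_le fun h => ?_
  rintro _ ⟨x, rfl⟩
  have h' : S.card < T'.card := h.trans_le (FI.card_le_of_hom g)
  have hx : (W.map (f ≫ g)).hom x ∈ W.decomposables T' :=
    Submodule.mem_iSup_of_mem S (Submodule.mem_iSup_of_mem (f ≫ g)
      (Submodule.mem_iSup_of_mem h' ⟨x, rfl⟩))
  simpa using hx

lemma decomposables_le_comap_app {V W : FIMod.{u, v}} (φ : V ⟶ W) (T : FI.{u}) :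
    V.decomposables T ≤ (W.decomposables T).comap (φ.app T).hom := by
  refine iSup_le fun S => iSup_le fun f => iSup_le fun h => ?_
  rintro _ ⟨x, rfl⟩
  have hx : (W.map f).hom ((φ.app S).hom x) ∈ W.decomposables T :=
    Submodule.mem_iSup_of_mem S (Submodule.mem_iSup_of_mem f
      (Submodule.mem_iSup_of_mem h ⟨_, rfl⟩))
  have e : (φ.app T).hom ((V.map f).hom x) = (W.map f).hom ((φ.app S).hom x) :=
    NatTrans.naturality_apply φ f x
  rw [Submodule.mem_comap, e]
  exact hx

/-- The abelian group `H₀(W)_T`, the quotient of `W_T` by the images of all maps `W_S → W_T`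
with `|S| < |T|`. -/
abbrev indecomposables (W : FIMod.{u, v}) (T : FI.{u}) : ModuleCat.{v} ℤ :=
  ModuleCat.of ℤ (W.obj T ⧸ W.decomposables T)

/-- The map `H₀(W)_T → H₀(W)_T'` induced by an injection `T → T'`. -/
def indecomposablesMap (W : FIMod.{u, v}) {T T' : FI.{u}} (g : T ⟶ T') :
    W.indecomposables T ⟶ W.indecomposables T' :=
  ModuleCat.ofHom (Submodule.mapQ _ _ (W.map g).hom (W.decomposables_le_comap_map g))

/-- The map `H₀(V)_T → H₀(W)_T` induced by a map of `FI`-modules `V → W`. -/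
def indecomposablesApp {V W : FIMod.{u, v}} (φ : V ⟶ W) (T : FI.{u}) :
    V.indecomposables T ⟶ W.indecomposables T :=
  ModuleCat.ofHom (Submodule.mapQ _ _ (φ.app T).hom (decomposables_le_comap_app φ T))

/-- The `FI`-module `H₀(W)`. -/
def H0obj (W : FIMod.{u, v}) : FIMod.{u, v} where
  obj T := W.indecomposables T
  map g := W.indecomposablesMap g
  map_id T := by
    ext x
    obtain ⟨x, rfl⟩ := Submodule.mkQ_surjective _ x
    simp [indecomposablesMap]
  map_comp f g := by
    ext x
    obtain ⟨x, rfl⟩ := Submodule.mkQ_surjective _ x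
    simp [indecomposablesMap]

/-- The functor `H₀` from `FI`-modules to `FI`-modules. -/
def H0 : FIMod.{u, v} ⥤ FIMod.{u, v} where
  obj W := W.H0obj
  map {V W} φ :=
    { app := fun T => indecomposablesApp φ T
      naturality := by
        intro S T f
        refine ModuleCat.hom_ext (LinearMap.ext fun x => ?_)
        obtain ⟨x, rfl⟩ := (V.decomposables S).mkQ_surjective x
        exact congrArg (W.decomposables T).mkQ (NatTrans.naturality_apply φ f x) }
  map_id W := by
    refine NatTrans.ext (funext fun T => ModuleCat.hom_ext (LinearMap.ext fun x => ?_))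
    obtain ⟨x, rfl⟩ := (W.decomposables T).mkQ_surjective x
    rfl
  map_comp {U V W} φ ψ := by
    refine NatTrans.ext (funext fun T => ModuleCat.hom_ext (LinearMap.ext fun x => ?_))
    obtain ⟨x, rfl⟩ := (U.decomposables T).mkQ_surjective x
    rfl

instance : (H0.{u, v}).Additive where
  map_add {V W φ ψ} := by
    refine NatTrans.ext (funext fun T => ModuleCat.hom_ext (LinearMap.ext fun x => ?_))
    obtain ⟨x, rfl⟩ := (V.decomposables T).mkQ_surjective x
    rfl

/-- The category of `FI`-modules has enough projectives, so left derived functors exist. -/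
instance : EnoughProjectives FIMod.{u, v} where
  presentation W := by
    let L (n : ℕ) := evaluationLeftAdjoint (ModuleCat.{v} ℤ) (FI.std.{u} n)
    let adj (n : ℕ) : L n ⊣ _ := evaluationAdjunctionRight (ModuleCat.{v} ℤ) (FI.std.{u} n)
    let P (n : ℕ) : FIMod.{u, v} := (L n).obj (Projective.over (W.obj (FI.std n)))
    have hP (n : ℕ) : Projective (P n) := (adj n).map_projective _ inferInstance
    let p (n : ℕ) : P n ⟶ W := ((adj n).homEquiv _ W).symm (Projective.π (W.obj (FI.std n)))
    have hp (n : ℕ) : Epi ((p n).app (FI.std n)) := by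
      have h : ((adj n).homEquiv _ W) (p n) = Projective.π (W.obj (FI.std n)) :=
        Equiv.apply_symm_apply _ _
      rw [Adjunction.homEquiv_unit] at h
      have : Epi ((adj n).unit.app (Projective.over (W.obj (FI.std n))) ≫
          ((evaluation _ _).obj (FI.std n)).map (p n)) := by
        rw [h]; exact Projective.π_epi (W.obj (FI.std n))
      exact epi_of_epi ((adj n).unit.app (Projective.over (W.obj (FI.std n))))
        (((evaluation _ _).obj (FI.std n)).map (p n))
    let q : ∐ P ⟶ W := Sigma.desc p
    have h (T : FI.{u}) : Epi (q.app T) := by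
      obtain ⟨e⟩ := T.nonempty_iso_std
      have h1 : Epi (q.app (FI.std T.card)) := by
        have h2 : (Sigma.ι P T.card).app (FI.std T.card) ≫ q.app (FI.std T.card)
            = (p T.card).app (FI.std T.card) := by
          rw [← NatTrans.comp_app, Sigma.ι_desc]
        have := hp T.card
        rw [← h2] at this
        exact epi_of_epi ((Sigma.ι P T.card).app (FI.std T.card)) _
      have h3 : (∐ P).map e.hom ≫ q.app T
          = q.app (FI.std T.card) ≫ W.map e.hom := NatTrans.naturality _ _
      have : Epi ((∐ P).map e.hom ≫ q.app T) := by
        rw [h3]; exact epi_comp _ _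
      exact epi_of_epi ((∐ P).map e.hom) _
    have hq : Projective (∐ P) :=
      ⟨fun f e _ => ⟨Sigma.desc fun n => Projective.factorThru (Sigma.ι P n ≫ f) e,
        Sigma.hom_ext _ _ fun n => by simp⟩⟩
    exact ⟨{ p := ∐ P, projective := hq, f := q, epi := NatTrans.epi_of_epi_app q }⟩

/-- `FI`-homology: `H p` is the `p`-th left derived functor of `H0`. -/
noncomputable def H (p : ℕ) : FIMod.{u, v} ⥤ FIMod.{u, v} := (H0.{u, v}).leftDerived p

/-- The poset, under inclusion, of the subsets of `T` with at most `N` elements. -/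
abbrev SmallSubsets (T : FI.{u}) (N : WithBot ℕ∞) : Type u :=
  {S : Set T.carrier // ((S.encard : ℕ∞) : WithBot ℕ∞) ≤ N}

/-- A subset of at most `N` elements of `T` is a finite set, and an inclusion of such subsets is
an injection. -/
def smallSubsetsFunctor (T : FI.{u}) (N : WithBot ℕ∞) : SmallSubsets T N ⥤ FI.{u} where
  obj S := ⟨S.1⟩
  map {S S'} h := Set.embeddingOfSubset S.1 S'.1 (leOfHom h)

/-- The diagram of the groups `W_S`, where `S` runs over the subsets of `T` with `|S| ≤ N`. -/
def smallSubsetsDiagram (W : FIMod.{u, v}) (T : FI.{u}) (N : WithBot ℕ∞) :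
    SmallSubsets T N ⥤ ModuleCat.{v} ℤ :=
  smallSubsetsFunctor T N ⋙ W

/-- The maps `W_S → W_T` induced by the inclusions of the subsets `S` of `T` with `|S| ≤ N`. -/
def smallSubsetsCocone (W : FIMod.{u, v}) (T : FI.{u}) (N : WithBot ℕ∞) :
    Cocone (W.smallSubsetsDiagram T N) where
  pt := W.obj T
  ι :=
    { app := fun S => W.map
        (show (smallSubsetsFunctor T N).obj S ⟶ T from Function.Embedding.subtype (· ∈ S.1))
      naturality := by
        intro S S' h
        refine Eq.trans ?_ (Category.comp_id _).symm
        exact (W.map_comp _ _).symm }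

/-- The property `W_T = colim W_S` over the subsets `S` of `T` with `|S| ≤ N`: the canonical maps
`W_S → W_T` form a colimit cocone. -/
def IsColimitOfSmallSubsets (W : FIMod.{u, v}) (T : FI.{u}) (N : WithBot ℕ∞) : Prop :=
  Nonempty (IsColimit (W.smallSubsetsCocone T N))

end FIMod

/-! Say that `W` is determined at `T` if `W_T` is the colimit of the `W_S` over injections `S → T`
with `|S| < |T|`. By induction on `|T|`, the colimit property over sets of size at most `K` holds
for all `T` if and only if `W` is determined at every `T` with `|T| > K`
(`forall_extendsUniquely_iff`).

Being determined at `T` is equivalent to `H₀(W)_T = 0 = H₁(W)_T` (`extendsUniquely_iff_isZero`).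
Choose a surjection `P → W` with `P` projective and kernel `Z`. Uniqueness of extensions out of
`W_T` amounts to `H₀(W)_T = 0`. The group `H₁(W)_T` is the kernel of `H₀(Z)_T → H₀(P)_T`, so it
vanishes when each relation in `Z_T` that is decomposable in `P_T` comes from relations on smaller
sets. This is what lets an extension on `P` descend to `W`, and extensions on `P` exist by lifting
against coinduced modules.

Hence the colimit property for `K` is equivalent to `max (deg H₀) (deg H₁) ≤ K`, which gives both
the property for `N` and its minimality. -/

namespace FIMod

/-! ### Compatible families and induction on the size of the set -/

/-- A compatible family of maps `W_S → D`, one for each injection `S → T` whose source has a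
number of elements satisfying `q`. -/
structure CompatibleFamily (W : FIMod.{u, v}) (T : FI.{u}) (q : ℕ → Prop)
    (D : ModuleCat.{v} ℤ) where
  /-- The map `W_S → D` attached to an injection `S → T`. -/
  hom {S : FI.{u}} (f : S ⟶ T) (h : q S.card) : W.obj S ⟶ D
  comp {S S' : FI.{u}} (g : S ⟶ S') (f : S' ⟶ T) (h : q S.card) (h' : q S'.card) :
    hom (g ≫ f) h = W.map g ≫ hom f h'

/-- A map `W_T → D` extends a compatible family if it restricts to each of its members. -/
def CompatibleFamily.IsExtension {W : FIMod.{u, v}} {T : FI.{u}} {q : ℕ → Prop}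
    {D : ModuleCat.{v} ℤ} (F : CompatibleFamily W T q D) (θ : W.obj T ⟶ D) : Prop :=
  ∀ ⦃S : FI.{u}⦄ (f : S ⟶ T) (h : q S.card), W.map f ≫ θ = F.hom f h

/-- The family on `T'` obtained from a family on `T` by composition with an injection. -/
def CompatibleFamily.pullback {W : FIMod.{u, v}} {T T' : FI.{u}} {q : ℕ → Prop}
    {D : ModuleCat.{v} ℤ} (F : CompatibleFamily W T q D) (e : T' ⟶ T) :
    CompatibleFamily W T' q D where
  hom f h := F.hom (f ≫ e) h
  comp g f h h' := by rw [Category.assoc, F.comp g (f ≫ e) h h']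

/-- A family restricted to fewer injections. -/
def CompatibleFamily.restrict {W : FIMod.{u, v}} {T : FI.{u}} {q r : ℕ → Prop}
    {D : ModuleCat.{v} ℤ} (F : CompatibleFamily W T q D) (hr : ∀ n, r n → q n) :
    CompatibleFamily W T r D where
  hom f h := F.hom f (hr _ h)
  comp g f _ _ := F.comp g f _ _

/-- The family of the restrictions of a map. -/
def CompatibleFamily.ofHom {W : FIMod.{u, v}} {T : FI.{u}} (q : ℕ → Prop)
    {D : ModuleCat.{v} ℤ} (θ : W.obj T ⟶ D) : CompatibleFamily W T q D where
  hom f _ := W.map f ≫ θ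
  comp g f _ _ := by simp

/-- Every compatible family extends uniquely to `W_T`. -/
def ExtendsUniquely (W : FIMod.{u, v}) (T : FI.{u}) (q : ℕ → Prop) : Prop :=
  ∀ ⦃D : ModuleCat.{v} ℤ⦄ (F : CompatibleFamily W T q D), ∃! θ : W.obj T ⟶ D, F.IsExtension θ

lemma ExtendsUniquely.hom_ext {W : FIMod.{u, v}} {T : FI.{u}} {q : ℕ → Prop}
    (hW : W.ExtendsUniquely T q) {D : ModuleCat.{v} ℤ} {θ θ' : W.obj T ⟶ D}
    (h : ∀ ⦃S : FI.{u}⦄ (f : S ⟶ T), q S.card → W.map f ≫ θ = W.map f ≫ θ') : θ = θ' :=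
  (hW (CompatibleFamily.ofHom q θ')).unique (fun _ f hf => h f hf) (fun _ _ _ => rfl)

lemma extendsUniquely_of_card {W : FIMod.{u, v}} {T : FI.{u}} {q : ℕ → Prop} (hT : q T.card) :
    W.ExtendsUniquely T q := by
  intro D F
  refine ⟨F.hom (𝟙 T) hT, fun S f h => ?_, fun θ hθ => ?_⟩
  · rw [← F.comp f (𝟙 T) h hT, Category.comp_id]
  · rw [← hθ (𝟙 T) hT, W.map_id, Category.id_comp]

/-- Families on the small sets extend uniquely if and only if, on every set that is not small,
families on the sets with fewer elements do. -/
lemma forall_extendsUniquely_iff (W : FIMod.{u, v}) (q : ℕ → Prop)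
    (hq : ∀ ⦃m n⦄, m ≤ n → q n → q m) :
    (∀ T : FI.{u}, W.ExtendsUniquely T q) ↔
      ∀ T : FI.{u}, ¬ q T.card → W.ExtendsUniquely T (· < T.card) := by
  have lt_of {m n : ℕ} (hm : q m) (hn : ¬ q n) : m < n :=
    lt_of_not_ge fun h => hn (hq h hm)
  constructor
  · intro H T hT D F
    -- Only the small part of `F` is used to build `θ`; on a larger `S` it agrees with `F` because
    -- maps out of `W_S` are determined on small sets.
    obtain ⟨θ, hθ, huniq⟩ := H T (F.restrict fun m hm => lt_of hm hT)
    refine ⟨θ, fun S f hS => (H S).hom_ext fun S' g hS' => ?_, fun θ' hθ' => huniq θ' ?_⟩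
    · rw [← Category.assoc, ← W.map_comp, hθ (g ≫ f) hS']
      exact F.comp g f (lt_of hS' hT) hS
    · exact fun S f hS => hθ' f (lt_of hS hT)
  · intro H
    suffices ∀ n, ∀ T : FI.{u}, T.card = n → W.ExtendsUniquely T q from fun T => this _ T rfl
    intro n
    induction n using Nat.strong_induction_on with
    | _ n ih =>
    rintro T rfl
    by_cases hT : q T.card
    · exact extendsUniquely_of_card hT
    intro D F
    have IH (S : FI.{u}) (hS : S.card < T.card) : W.ExtendsUniquely S q := ih _ hS S rfl
    -- By induction `F` extends to each set smaller than `T`, and uniqueness makes these extensions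
    -- a compatible family `G`.
    choose φ hφ using fun (S : FI.{u}) (f : S ⟶ T) (hS : S.card < T.card) =>
      (IH S hS (F.pullback f)).exists
    let G : CompatibleFamily W T (· < T.card) D :=
      { hom := fun f h => φ _ f h
        comp := fun {S S'} g f h h' => (IH S h).hom_ext fun U e hU => by
          rw [hφ S (g ≫ f) h e hU, ← Category.assoc, ← W.map_comp, hφ S' f h' (e ≫ g) hU]
          simp [CompatibleFamily.pullback] }
    obtain ⟨θ, hθ, huniq⟩ := H T hT G
    refine ⟨θ, fun S f hS => ?_, fun θ' hθ' => huniq θ' fun S f hS =>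
      (IH S hS).hom_ext fun U e hU => ?_⟩
    · have hS' := lt_of hS hT
      have h := hφ S f hS' (𝟙 S) hS
      rw [W.map_id, Category.id_comp] at h
      rw [hθ f hS']
      simpa [CompatibleFamily.pullback] using h
    · rw [← Category.assoc, ← W.map_comp, hθ' (e ≫ f) hU]
      exact (hφ S f hS e hU).symm

/-! ### From injections into `T` to subsets of `T` -/

/-- The inclusion of a subset, as a morphism of `FI`. -/
def subsetInclusion (T : FI.{u}) (S : Set T.carrier) : (⟨S⟩ : FI.{u}) ⟶ T :=
  Function.Embedding.subtype (· ∈ S)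

/-- The range of a morphism of `FI`. -/
def homRange {S T : FI.{u}} (f : S ⟶ T) : Set T.carrier :=
  Set.range (show S.carrier ↪ T.carrier from f)

/-- An injection is a bijection onto its range. -/
noncomputable def homRangeEquiv {S T : FI.{u}} (f : S ⟶ T) : S.carrier ≃ homRange f :=
  Equiv.ofInjective _ (show S.carrier ↪ T.carrier from f).injective

/-- An injection is an isomorphism onto its range. -/
noncomputable def homRangeIso {S T : FI.{u}} (f : S ⟶ T) : S ≅ (⟨homRange f⟩ : FI.{u}) where
  hom := (homRangeEquiv f).toEmbedding
  inv := (homRangeEquiv f).symm.toEmbedding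
  hom_inv_id := Function.Embedding.ext fun x => (homRangeEquiv f).symm_apply_apply x
  inv_hom_id := Function.Embedding.ext fun x => (homRangeEquiv f).apply_symm_apply x

lemma homRangeIso_hom_comp {S T : FI.{u}} (f : S ⟶ T) :
    (homRangeIso f).hom ≫ subsetInclusion T (homRange f) = f :=
  Function.Embedding.ext fun _ => rfl

lemma map_comp_eq_map_homRangeIso_comp (W : FIMod.{u, v}) {S T : FI.{u}} (f : S ⟶ T)
    {D : ModuleCat.{v} ℤ} (θ : W.obj T ⟶ D) :
    W.map f ≫ θ
      = W.map (homRangeIso f).hom ≫ W.map (subsetInclusion T (homRange f)) ≫ θ := by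
  rw [← W.map_comp_assoc, homRangeIso_hom_comp]

lemma card_eq_of_iso {S T : FI.{u}} (e : S ≅ T) : S.card = T.card :=
  le_antisymm (FI.card_le_of_hom e.hom) (FI.card_le_of_hom e.inv)

lemma encard_eq_card {T : FI.{u}} (S : Set T.carrier) :
    S.encard = ((⟨S⟩ : FI.{u}).card : ℕ∞) :=
  S.toFinite.cast_ncard_eq.symm

/-- The morphism of `FI` given by an inclusion of subsets. -/
def subsetHom {T : FI.{u}} {S S' : Set T.carrier} (h : S ⊆ S') :
    (⟨S⟩ : FI.{u}) ⟶ ⟨S'⟩ :=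
  Set.embeddingOfSubset S S' h

lemma homRange_comp_subset {S S' T : FI.{u}} (g : S ⟶ S') (f : S' ⟶ T) :
    homRange (g ≫ f) ⊆ homRange f := by
  rintro _ ⟨x, rfl⟩
  exact ⟨(show S.carrier ↪ S'.carrier from g) x, rfl⟩

lemma homRangeIso_comp {S S' T : FI.{u}} (g : S ⟶ S') (f : S' ⟶ T) :
    (homRangeIso (g ≫ f)).hom ≫ subsetHom (homRange_comp_subset g f)
      = g ≫ (homRangeIso f).hom :=
  Function.Embedding.ext fun _ => rfl

lemma subset_homRange_subsetInclusion {T : FI.{u}} (S : Set T.carrier) :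
    S ⊆ homRange (subsetInclusion T S) :=
  fun x hx => ⟨⟨x, hx⟩, rfl⟩

lemma homRangeIso_subsetInclusion {T : FI.{u}} (S : Set T.carrier) :
    (homRangeIso (subsetInclusion T S)).hom = subsetHom (subset_homRange_subsetInclusion S) :=
  Function.Embedding.ext fun _ => rfl

lemma encard_homRange {S T : FI.{u}} (f : S ⟶ T) : (homRange f).encard = (S.card : ℕ∞) := by
  rw [encard_eq_card, ← card_eq_of_iso (homRangeIso f)]

/-- Each injection is an isomorphism onto its range followed by an inclusion, so a cocone over
subsets carries the same data as a compatible family over injections. -/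
lemma isColimitOfSmallSubsets_iff (W : FIMod.{u, v}) (T : FI.{u}) (N : WithBot ℕ∞) :
    W.IsColimitOfSmallSubsets T N ↔
      W.ExtendsUniquely T (fun n => ((n : ℕ∞) : WithBot ℕ∞) ≤ N) := by
  have small {S : FI.{u}} (f : S ⟶ T) (h : ((S.card : ℕ∞) : WithBot ℕ∞) ≤ N) :
      (((homRange f).encard : ℕ∞) : WithBot ℕ∞) ≤ N := by
    rwa [encard_homRange]
  have hS (S : SmallSubsets T N) : (((⟨S.1⟩ : FI.{u}).card : ℕ∞) : WithBot ℕ∞) ≤ N := by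
    rw [← encard_eq_card]; exact S.2
  constructor
  · rintro ⟨hc⟩ D F
    let s : Cocone (W.smallSubsetsDiagram T N) :=
      { pt := D
        ι :=
          { app := fun S => F.hom (subsetInclusion T S.1) (hS S)
            naturality := fun S S' h =>
              ((F.comp ((smallSubsetsFunctor T N).map h) (subsetInclusion T S'.1)
                (hS S) (hS S')).symm).trans (Category.comp_id _).symm } }
    refine ⟨hc.desc s, fun S f h => ?_, fun θ hθ => hc.uniq s θ fun S => hθ _ (hS S)⟩
    have hR := hS ⟨_, small f h⟩
    have hfac : W.map (subsetInclusion T (homRange f)) ≫ hc.desc s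
        = F.hom (subsetInclusion T (homRange f)) hR := hc.fac s ⟨_, small f h⟩
    have hf := F.comp (homRangeIso f).hom (subsetInclusion T (homRange f)) h hR
    simp only [homRangeIso_hom_comp] at hf
    rw [hf]
    exact (map_comp_eq_map_homRangeIso_comp W f _).trans
      (congrArg (W.map (homRangeIso f).hom ≫ ·) hfac)
  · intro H
    let a (s : Cocone (W.smallSubsetsDiagram T N)) (S : Set T.carrier)
        (h : ((S.encard : ℕ∞) : WithBot ℕ∞) ≤ N) : W.obj ⟨S⟩ ⟶ s.pt := s.ι.app ⟨S, h⟩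
    have ha (s : Cocone (W.smallSubsetsDiagram T N)) {S S' : Set T.carrier} (hSS' : S ⊆ S')
        (h : ((S.encard : ℕ∞) : WithBot ℕ∞) ≤ N) (h' : ((S'.encard : ℕ∞) : WithBot ℕ∞) ≤ N) :
        W.map (subsetHom hSS') ≫ a s S' h' = a s S h :=
      s.w (homOfLE (show (⟨S, h⟩ : SmallSubsets T N) ≤ ⟨S', h'⟩ from hSS'))
    let F (s : Cocone (W.smallSubsetsDiagram T N)) :
        CompatibleFamily W T (fun n => ((n : ℕ∞) : WithBot ℕ∞) ≤ N) s.pt :=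
      { hom := fun f h => W.map (homRangeIso f).hom ≫ a s _ (small f h)
        comp := fun g f h h' => by
          rw [← ha s (homRange_comp_subset g f) (small (g ≫ f) h) (small f h'),
            ← W.map_comp_assoc, homRangeIso_comp, W.map_comp_assoc] }
    choose d hd using fun s => (H (F s)).exists
    refine ⟨⟨d, fun s S => ?_, fun s m hm => (H _).unique (fun S f h => ?_) (hd s)⟩⟩
    · refine (hd s (subsetInclusion T S.1) (hS S)).trans ?_
      change W.map (homRangeIso (subsetInclusion T S.1)).hom ≫ a s _ _ = a s S.1 S.2
      rw [homRangeIso_subsetInclusion, ha]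
    · exact (map_comp_eq_map_homRangeIso_comp W f _).trans
        (congrArg (W.map (homRangeIso f).hom ≫ ·) (hm ⟨_, small f h⟩))

end FIMod

/-! ### Coinduced modules and extension on projectives -/

namespace FIMod

/-- The injections `U → T`, provided that the number of elements of `U` satisfies `q`. -/
abbrev HomOfCard (q : ℕ → Prop) (U T : FI.{u}) : Type u := {_f : U ⟶ T // q U.card}

/-- The `FI`-module `U ↦ ∏ D`, where the product is over the injections `U → T` and is empty
unless the number of elements of `U` satisfies `q`. -/
noncomputable def coinduced (T : FI.{u}) (q : ℕ → Prop) (hq : ∀ ⦃m n⦄, m ≤ n → q n → q m)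
    (D : ModuleCat.{v} ℤ) : FIMod.{u, v} where
  obj U := ∏ᶜ fun _ : HomOfCard q U T => D
  map {U V} g := Pi.lift fun f : HomOfCard q V T =>
    Pi.π (fun _ : HomOfCard q U T => D) ⟨g ≫ f.1, hq (FI.card_le_of_hom g) f.2⟩
  map_id U := by
    refine Pi.hom_ext _ _ fun f => ?_
    simp
  map_comp f g := by
    refine Pi.hom_ext _ _ fun f => ?_
    simp

namespace coinduced

variable {T : FI.{u}} {q : ℕ → Prop} {hq : ∀ ⦃m n⦄, m ≤ n → q n → q m} {D : ModuleCat.{v} ℤ}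

/-- The projection of the coinduced module to the factor of an injection. -/
noncomputable def π {U : FI.{u}} (f : U ⟶ T) (h : q U.card) : (coinduced T q hq D).obj U ⟶ D :=
  Pi.π (fun _ : HomOfCard q U T => D) ⟨f, h⟩

lemma hom_ext {U : FI.{u}} {M : ModuleCat.{v} ℤ} {φ ψ : M ⟶ (coinduced T q hq D).obj U}
    (H : ∀ f h, φ ≫ π f h = ψ ≫ π f h) : φ = ψ :=
  Pi.hom_ext _ _ fun f => H f.1 f.2

lemma map_π {U V : FI.{u}} (g : U ⟶ V) (f : V ⟶ T) (h : q V.card) :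
    (coinduced T q hq D).map g ≫ π f h = π (g ≫ f) (hq (FI.card_le_of_hom g) h) :=
  Pi.lift_π _ _

/-- The map to the coinduced module with given components. -/
noncomputable def lift {U : FI.{u}} {M : ModuleCat.{v} ℤ}
    (φ : ∀ _ : U ⟶ T, q U.card → (M ⟶ D)) : M ⟶ (coinduced T q hq D).obj U :=
  Pi.lift fun f : HomOfCard q U T => φ f.1 f.2

lemma lift_π {U : FI.{u}} {M : ModuleCat.{v} ℤ} (φ : ∀ _ : U ⟶ T, q U.card → (M ⟶ D))
    (f : U ⟶ T) (h : q U.card) : lift (hq := hq) φ ≫ π f h = φ f h :=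
  Pi.lift_π _ _

/-- The restriction of a coinduced module to fewer injections. -/
noncomputable def restrict (T : FI.{u}) (hq : ∀ ⦃m n⦄, m ≤ n → q n → q m)
    (D : ModuleCat.{v} ℤ) :
    coinduced T (fun _ => True) (fun _ _ _ h => h) D ⟶ coinduced T q hq D where
  app U := lift fun f _ => π f trivial
  naturality U V g := hom_ext fun f h => by simp only [Category.assoc, lift_π, map_π]

/-- Checked pointwise: where `q` holds, both products run over all injections `U → T`; elsewhere the
target is an empty product, hence zero. -/
instance : Epi (restrict T hq D) := by
  have (U : FI.{u}) : Epi ((restrict T hq D).app U) := by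
    by_cases h : q U.card
    · have : IsSplitEpi ((restrict T hq D).app U) :=
        ⟨⟨lift fun f _ => π f h, hom_ext fun f h => by simp [restrict, lift_π]⟩⟩
      infer_instance
    · exact ⟨fun a b _ => ((IsZero.iff_id_eq_zero _).2
        (hom_ext fun f hf => absurd hf h)).eq_of_src a b⟩
  exact NatTrans.epi_of_epi_app _

end coinduced

/-- The map to the coinduced module attached to a compatible family. -/
noncomputable def CompatibleFamily.toCoinduced {W : FIMod.{u, v}} {T : FI.{u}} {q : ℕ → Prop}
    {D : ModuleCat.{v} ℤ} (F : CompatibleFamily W T q D) (hq : ∀ ⦃m n⦄, m ≤ n → q n → q m) :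
    W ⟶ coinduced T q hq D where
  app U := coinduced.lift fun f h => F.hom f h
  naturality U V g := coinduced.hom_ext fun f h => by
    simp only [Category.assoc, coinduced.lift_π, coinduced.map_π]
    exact (F.comp g f _ h).symm

/-- On a projective `FI`-module every compatible family extends. -/
lemma CompatibleFamily.exists_isExtension_of_projective {P : FIMod.{u, v}} [Projective P]
    {T : FI.{u}} {q : ℕ → Prop} (hq : ∀ ⦃m n⦄, m ≤ n → q n → q m)
    {D : ModuleCat.{v} ℤ} (F : CompatibleFamily P T q D) :
    ∃ θ : P.obj T ⟶ D, F.IsExtension θ := by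
  -- A family is a map to the coinduced module for `q`. Lifting it to the full coinduced module
  -- creates a component at the identity of `T`, which is the extension.
  let ψ := Projective.factorThru (F.toCoinduced hq) (coinduced.restrict T hq D)
  have hψ : ψ ≫ coinduced.restrict T hq D = F.toCoinduced hq := Projective.factorThru_comp _ _
  refine ⟨ψ.app T ≫ coinduced.π (𝟙 T) trivial, fun S f h => ?_⟩
  have hS := congrArg (fun α => α.app S ≫ coinduced.π f h) hψ
  simp only [NatTrans.comp_app, coinduced.restrict, CompatibleFamily.toCoinduced, Category.assoc,
    coinduced.lift_π] at hS
  rw [← hS, ψ.naturality_assoc, coinduced.map_π]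
  simp only [Category.comp_id]

end FIMod

/-! ### Factoring linear maps through surjections -/

section ModuleCat

variable {R : Type*} [Ring R]

lemma ModuleCat.exists_hom_eq_zero_iff_mem {A : ModuleCat.{v} R} (p : Submodule R A) :
    ∃ (D : ModuleCat.{v} R) (π : A ⟶ D), ∀ x, π.hom x = 0 ↔ x ∈ p :=
  ⟨ModuleCat.of R (A ⧸ p), ModuleCat.ofHom p.mkQ, fun _ => Submodule.Quotient.mk_eq_zero p⟩

/-- A map that kills the elements of a submodule killed by `f` factors through `f` on that
submodule, if `f` is surjective on it. -/
lemma ModuleCat.exists_hom_apply_eq_of_mem {A B D : ModuleCat.{v} R} (f : A ⟶ B) (g : A ⟶ D)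
    (p : Submodule R A) (hp : p.map f.hom = ⊤)
    (h : LinearMap.ker f.hom ⊓ p ≤ LinearMap.ker g.hom) :
    ∃ φ : B ⟶ D, ∀ x ∈ p, φ.hom (f.hom x) = g.hom x := by
  let r : p →ₗ[R] B := f.hom.comp p.subtype
  have hr : Function.Surjective r := fun b => by
    obtain ⟨x, hx, rfl⟩ := hp.symm ▸ Submodule.mem_top (x := b)
    exact ⟨⟨x, hx⟩, rfl⟩
  have hle : LinearMap.ker r ≤ LinearMap.ker (g.hom.comp p.subtype) := fun x hx => h ⟨hx, x.2⟩
  let e := r.quotKerEquivOfSurjective hr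
  refine ⟨ModuleCat.ofHom ((Submodule.liftQ _ _ hle).comp e.symm.toLinearMap), fun x hx => ?_⟩
  have hx : e (Submodule.Quotient.mk ⟨x, hx⟩) = f.hom x := rfl
  change Submodule.liftQ _ _ hle (e.symm (f.hom x)) = _
  rw [← hx, e.symm_apply_apply]
  rfl

lemma ModuleCat.exists_comp_eq_of_ker_le {A B D : ModuleCat.{v} R} (f : A ⟶ B) (g : A ⟶ D)
    (hf : Function.Surjective f.hom) (h : LinearMap.ker f.hom ≤ LinearMap.ker g.hom) :
    ∃ φ : B ⟶ D, f ≫ φ = g := by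
  obtain ⟨φ, hφ⟩ := ModuleCat.exists_hom_apply_eq_of_mem f g ⊤
    (by rw [Submodule.map_top, LinearMap.range_eq_top.2 hf]) (inf_le_left.trans h)
  exact ⟨φ, ModuleCat.hom_ext (LinearMap.ext fun x => hφ x trivial)⟩

end ModuleCat

/-! ### Decomposable elements and decomposable relations -/

namespace FIMod

lemma map_mem_decomposables (W : FIMod.{u, v}) {S T : FI.{u}} (f : S ⟶ T) (h : S.card < T.card)
    (x : W.obj S) : (W.map f).hom x ∈ W.decomposables T :=
  Submodule.mem_iSup_of_mem S (Submodule.mem_iSup_of_mem f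
    (Submodule.mem_iSup_of_mem h ⟨x, rfl⟩))

lemma decomposables_le_iff (W : FIMod.{u, v}) {T : FI.{u}} {p : Submodule ℤ (W.obj T)} :
    W.decomposables T ≤ p ↔
      ∀ ⦃S : FI.{u}⦄ (f : S ⟶ T), S.card < T.card → ∀ x : W.obj S, (W.map f).hom x ∈ p := by
  refine ⟨fun H S f h x => H (W.map_mem_decomposables f h x), fun H => ?_⟩
  refine iSup_le fun S => iSup_le fun f => iSup_le fun h => ?_
  rintro _ ⟨x, rfl⟩
  exact H f h x

/-- The decomposable elements of the kernel of a map of `FI`-modules, as elements of its source. -/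
def kernelDecomposables {P W : FIMod.{u, v}} (p : P ⟶ W) (T : FI.{u}) :
    Submodule ℤ (P.obj T) :=
  ⨆ (S : FI.{u}) (f : S ⟶ T) (_ : S.card < T.card),
    (LinearMap.ker (p.app S).hom).map (P.map f).hom

lemma map_mem_kernelDecomposables {P W : FIMod.{u, v}} (p : P ⟶ W) {S T : FI.{u}} (f : S ⟶ T)
    (h : S.card < T.card) {x : P.obj S} (hx : (p.app S).hom x = 0) :
    (P.map f).hom x ∈ kernelDecomposables p T :=
  Submodule.mem_iSup_of_mem S (Submodule.mem_iSup_of_mem f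
    (Submodule.mem_iSup_of_mem h ⟨x, hx, rfl⟩))

lemma kernelDecomposables_le_iff {P W : FIMod.{u, v}} (p : P ⟶ W) {T : FI.{u}}
    {M : Submodule ℤ (P.obj T)} :
    kernelDecomposables p T ≤ M ↔ ∀ ⦃S : FI.{u}⦄ (f : S ⟶ T), S.card < T.card →
      ∀ x : P.obj S, (p.app S).hom x = 0 → (P.map f).hom x ∈ M := by
  refine ⟨fun H S f h x hx => H (map_mem_kernelDecomposables p f h hx), fun H => ?_⟩
  refine iSup_le fun S => iSup_le fun f => iSup_le fun h => ?_
  rintro _ ⟨x, hx, rfl⟩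
  exact H f h x hx

/-- The image of the decomposable elements under a surjection. -/
lemma map_decomposables_of_surjective {V W : FIMod.{u, v}} (p : V ⟶ W)
    (hp : ∀ S, Function.Surjective (p.app S).hom) (T : FI.{u}) :
    (V.decomposables T).map (p.app T).hom = W.decomposables T := by
  refine le_antisymm (Submodule.map_le_iff_le_comap.2 (decomposables_le_comap_app p T)) ?_
  refine (W.decomposables_le_iff).2 fun S f h x => ?_
  obtain ⟨y, rfl⟩ := hp S x
  exact ⟨_, V.map_mem_decomposables f h y, NatTrans.naturality_apply p f y⟩

/-- The quotient map by the decomposables and the zero map agree on all smaller sets, so they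
coincide. -/
lemma decomposables_eq_top_of_extendsUniquely {W : FIMod.{u, v}} {T : FI.{u}}
    (H : W.ExtendsUniquely T (· < T.card)) : W.decomposables T = ⊤ := by
  obtain ⟨D, π, hπ⟩ := ModuleCat.exists_hom_eq_zero_iff_mem (W.decomposables T)
  have e : π = 0 := H.hom_ext fun S f h => by
    refine ModuleCat.hom_ext (LinearMap.ext fun x => ?_)
    exact (hπ _).2 (W.map_mem_decomposables f h x)
  refine Submodule.eq_top_iff'.2 fun x => (hπ x).1 ?_
  rw [e]
  rfl

/-- A map out of `W_T` is determined by its restrictions to smaller sets, if the elements of `W_T`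
are decomposable. -/
lemma hom_ext_of_decomposables_eq_top {W : FIMod.{u, v}} {T : FI.{u}}
    (hW : W.decomposables T = ⊤) {D : ModuleCat.{v} ℤ} {θ θ' : W.obj T ⟶ D}
    (h : ∀ ⦃S : FI.{u}⦄ (f : S ⟶ T), S.card < T.card → W.map f ≫ θ = W.map f ≫ θ') :
    θ = θ' := by
  have hle : W.decomposables T ≤ LinearMap.eqLocus θ.hom θ'.hom :=
    (W.decomposables_le_iff).2 fun S f hS x => by
      have e : (W.map f ≫ θ).hom x = (W.map f ≫ θ').hom x := by rw [h f hS]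
      exact e
  exact ModuleCat.hom_ext (LinearMap.ext fun w => hle (hW ▸ Submodule.mem_top))

/-- A decomposable relation is a combination of relations in smaller degree, if compatible
families extend. -/
lemma ker_inf_decomposables_le_of_extendsUniquely {P W : FIMod.{u, v}} (p : P ⟶ W)
    (hp : ∀ S, Function.Surjective (p.app S).hom) {T : FI.{u}}
    (H : W.ExtendsUniquely T (· < T.card)) :
    LinearMap.ker (p.app T).hom ⊓ P.decomposables T ≤ kernelDecomposables p T := by
  -- The test object is `P_T` modulo the combinations of smaller relations: there the maps `P_S →
  -- P_T → D` descend to `W_S` and form a compatible family.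
  obtain ⟨D, mk, hmk⟩ := ModuleCat.exists_hom_eq_zero_iff_mem (kernelDecomposables p T)
  have key {S : FI.{u}} (f : S ⟶ T) (h : S.card < T.card) :
      ∃ φ : W.obj S ⟶ D, p.app S ≫ φ = P.map f ≫ mk :=
    ModuleCat.exists_comp_eq_of_ker_le _ _ (hp S) fun x hx =>
      (hmk _).2 (map_mem_kernelDecomposables p f h hx)
  have cancel {S : FI.{u}} {φ ψ : W.obj S ⟶ D} (h : p.app S ≫ φ = p.app S ≫ ψ) : φ = ψ := by
    have : Epi (p.app S) := (ModuleCat.epi_iff_surjective _).2 (hp S)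
    exact (cancel_epi _).1 h
  choose φ hφ using @key
  let F : CompatibleFamily W T (· < T.card) D :=
    { hom := φ
      comp := fun {S S'} g f h h' => cancel <| by
        rw [hφ, ← p.naturality_assoc, hφ, P.map_comp, Category.assoc] }
  obtain ⟨θ, hθ⟩ := (H F).exists
  have hdec : P.decomposables T ≤ LinearMap.eqLocus mk.hom (p.app T ≫ θ).hom := by
    refine (P.decomposables_le_iff).2 fun S f h x => ?_
    have e : P.map f ≫ p.app T ≫ θ = P.map f ≫ mk := by
      rw [p.naturality_assoc, hθ f h, ← hφ f h]
    exact (congrArg (fun α => α.hom x) e).symm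
  rintro x ⟨hx, hx'⟩
  refine (hmk x).1 (Eq.trans (hdec hx') ?_)
  change θ.hom ((p.app T).hom x) = 0
  rw [show (p.app T).hom x = 0 from hx, map_zero]

/-- Compatible families extend uniquely if the elements of `W_T` are decomposable and decomposable
relations are combinations of relations in smaller degree. -/
lemma extendsUniquely_of_ker_inf_decomposables_le {P W : FIMod.{u, v}} [Projective P] (p : P ⟶ W)
    (hp : ∀ S, Function.Surjective (p.app S).hom) {T : FI.{u}} (hW : W.decomposables T = ⊤)
    (H : LinearMap.ker (p.app T).hom ⊓ P.decomposables T ≤ kernelDecomposables p T) :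
    W.ExtendsUniquely T (· < T.card) := by
  intro D F
  let G : CompatibleFamily P T (· < T.card) D :=
    { hom := fun f h => p.app _ ≫ F.hom f h
      comp := fun g f h h' => by rw [F.comp g f h h', p.naturality_assoc] }
  obtain ⟨ψ, hψ⟩ := G.exists_isExtension_of_projective fun m n hmn hn => hmn.trans_lt hn
  have hker : kernelDecomposables p T ≤ LinearMap.ker ψ.hom := by
    refine (kernelDecomposables_le_iff p).2 fun S f h x hx => ?_
    refine (congrArg (fun α => α.hom x) (hψ f h)).trans ?_
    change (F.hom f h).hom ((p.app S).hom x) = 0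
    rw [hx, map_zero]
  -- `ψ` need not kill all of the kernel of `P_T → W_T`. It is descended only from the
  -- decomposables, which already surject onto `W_T`.
  obtain ⟨θ, hθ⟩ := ModuleCat.exists_hom_apply_eq_of_mem (p.app T) ψ (P.decomposables T)
    ((map_decomposables_of_surjective p hp T).trans hW) (H.trans hker)
  have hF : F.IsExtension θ := fun S f h => by
    refine ModuleCat.hom_ext (LinearMap.ext fun w => ?_)
    obtain ⟨x, rfl⟩ := hp S w
    have e : (p.app T).hom ((P.map f).hom x) = (W.map f).hom ((p.app S).hom x) :=
      NatTrans.naturality_apply p f x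
    change θ.hom ((W.map f).hom ((p.app S).hom x)) = _
    rw [← e]
    exact (hθ _ (P.map_mem_decomposables f h x)).trans (congrArg (fun α => α.hom x) (hψ f h))
  exact ⟨θ, hF, fun θ' hθ' => hom_ext_of_decomposables_eq_top hW fun S f h =>
    (hθ' f h).trans (hF f h).symm⟩

end FIMod

/-! ### Degrees, homology and the conclusion -/

namespace FIMod

lemma deg_le_iff (W : FIMod.{u, v}) (N : WithBot ℕ∞) :
    W.deg ≤ N ↔ ∀ T : FI.{u}, ¬ ((T.card : ℕ∞) : WithBot ℕ∞) ≤ N → IsZero (W.obj T) := by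
  have hmem : W.deg ∈ {k : WithBot ℕ∞ | ∀ n : ℕ, k < (n : WithBot ℕ∞) →
      IsZero (W.obj (FI.std n))} :=
    -- The order is well-founded and `⊤` lies in the set, so the infimum is attained.
    csInf_mem ⟨⊤, fun n hn => absurd hn not_top_lt⟩
  constructor
  · intro h T hT
    obtain ⟨e⟩ := T.nonempty_iso_std
    exact (hmem T.card (h.trans_lt (not_le.1 hT))).of_iso (W.mapIso e).symm
  · intro h
    refine csInf_le (OrderBot.bddBelow _) fun n hn => h _ ?_
    have hc : (FI.std.{u} n).card = n := by simp [FI.card, FI.std]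
    rw [hc]
    exact not_le.2 hn

lemma isZero_H0_obj_iff (W : FIMod.{u, v}) (T : FI.{u}) :
    IsZero ((H0.obj W).obj T) ↔ W.decomposables T = ⊤ := by
  rw [← Submodule.Quotient.subsingleton_iff]
  constructor
  · exact fun h => ModuleCat.subsingleton_of_isZero h
  · intro h
    have : Subsingleton ((H0.obj W).obj T) := h
    exact ModuleCat.isZero_of_subsingleton _

/-- An exact sequence of `FI`-modules is exact at each finite set. -/
lemma exact_apply {X : ShortComplex FIMod.{u, v}} (h : X.Exact) (T : FI.{u}) (x : X.X₂.obj T)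
    (hx : (X.g.app T).hom x = 0) : ∃ y : X.X₁.obj T, (X.f.app T).hom y = x :=
  (ShortComplex.moduleCat_exact_iff _).1 (h.map ((evaluation _ _).obj T)) x hx

/-- Evaluation at `T` is exact, so homology is computed pointwise. -/
lemma isZero_homology_obj_iff (X : ShortComplex FIMod.{u, v}) (T : FI.{u}) :
    IsZero (X.homology.obj T) ↔ ∀ x : X.X₂.obj T, (X.g.app T).hom x = 0 →
      ∃ y : X.X₁.obj T, (X.f.app T).hom y = x := by
  have e := X.mapHomologyIso ((evaluation FI.{u} (ModuleCat.{v} ℤ)).obj T)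
  rw [show IsZero (X.homology.obj T) ↔ _ from e.symm.isZero_iff,
    ← ShortComplex.exact_iff_isZero_homology, ShortComplex.moduleCat_exact_iff]
  rfl

lemma isZero_H1_obj_iff {W : FIMod.{u, v}} (P : ProjectiveResolution W) (T : FI.{u}) :
    IsZero (((H 1).obj W).obj T) ↔
      ∀ x : (H0.obj (P.complex.X 1)).obj T,
        ((H0.map (P.complex.d 1 0)).app T).hom x = 0 →
          ∃ y : (H0.obj (P.complex.X 2)).obj T,
            ((H0.map (P.complex.d 2 1)).app T).hom y = x := by
  let C := (H0.mapHomologicalComplex (ComplexShape.down ℕ)).obj P.complex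
  have e : (H 1).obj W ≅ (C.sc' 2 1 0).homology :=
    P.isoLeftDerivedObj H0 1 ≪≫ ShortComplex.homologyMapIso (C.isoSc' 2 1 0 (by simp) (by simp))
  have e' := (e.app T).isZero_iff
  exact e'.trans (isZero_homology_obj_iff _ T)

/-- The first homology vanishes if and only if decomposable relations between generators are
combinations of relations in smaller degree. -/
lemma isZero_H1_obj_iff_ker_inf_decomposables_le {W : FIMod.{u, v}}
    (P : ProjectiveResolution W) (p : P.complex.X 0 ⟶ W) (hp : P.complex.d 1 0 ≫ p = 0)
    (hexact : (ShortComplex.mk _ p hp).Exact) (T : FI.{u}) :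
    IsZero (((H 1).obj W).obj T) ↔
      LinearMap.ker (p.app T).hom ⊓ (P.complex.X 0).decomposables T ≤
        kernelDecomposables p T := by
  have hcomp (S : FI.{u}) (x) : (p.app S).hom (((P.complex.d 1 0).app S).hom x) = 0 :=
    congrArg (fun α => (α.app S).hom x) hp
  have hcomp' (x) : ((P.complex.d 1 0).app T).hom (((P.complex.d 2 1).app T).hom x) = 0 :=
    congrArg (fun α => (α.app T).hom x) (P.complex.d_comp_d 2 1 0)
  have hnat {S : FI.{u}} (f : S ⟶ T) (x) :
      ((P.complex.d 1 0).app T).hom (((P.complex.X 1).map f).hom x)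
        = ((P.complex.X 0).map f).hom (((P.complex.d 1 0).app S).hom x) :=
    NatTrans.naturality_apply (P.complex.d 1 0) f x
  -- By exactness `X 1` surjects onto the kernel of `p` on every set, so its decomposables map onto
  -- those of the kernel.
  have hmap : ((P.complex.X 1).decomposables T).map ((P.complex.d 1 0).app T).hom
      = kernelDecomposables p T := by
    refine le_antisymm ?_ ?_
    · refine Submodule.map_le_iff_le_comap.2 ((decomposables_le_iff _).2 fun S f h x => ?_)
      rw [Submodule.mem_comap, hnat]
      exact map_mem_kernelDecomposables p f h (hcomp S x)
    · refine (kernelDecomposables_le_iff p).2 fun S f h x hx => ?_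
      obtain ⟨y, rfl⟩ := exact_apply hexact S x hx
      exact ⟨_, map_mem_decomposables _ f h y, hnat f y⟩
  rw [isZero_H1_obj_iff P]
  constructor
  · rintro H x ⟨hx, hx'⟩
    obtain ⟨y, rfl⟩ := exact_apply hexact T x hx
    -- The class of `y` is a cycle, hence a boundary: `y - d z` is decomposable and has the same
    -- image as `y` under `d`.
    obtain ⟨z, hz⟩ := H (Submodule.Quotient.mk y) ((Submodule.Quotient.mk_eq_zero _).2 hx')
    obtain ⟨z, rfl⟩ := Submodule.Quotient.mk_surjective _ z
    have hd := (Submodule.Quotient.eq _).1 hz.symm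
    rw [← hmap]
    refine ⟨_, hd, ?_⟩
    rw [map_sub]
    exact (congrArg _ (hcomp' z)).trans (sub_zero _)
  · intro H x hx
    obtain ⟨x, rfl⟩ := Submodule.Quotient.mk_surjective _ x
    have hx' : ((P.complex.d 1 0).app T).hom x ∈ kernelDecomposables p T :=
      H ⟨hcomp T x, (Submodule.Quotient.mk_eq_zero _).1 hx⟩
    rw [← hmap] at hx'
    obtain ⟨y, hy, hxy⟩ := hx'
    -- With `y` decomposable and `d y = d x`, the cycle `x - y` is a boundary, and it represents the
    -- class of `x`.
    obtain ⟨z, hz⟩ := exact_apply (P.exact_succ 0) T (x - y)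
      (by
        refine (map_sub _ _ _).trans ?_
        exact sub_eq_zero.2 hxy.symm)
    refine ⟨Submodule.Quotient.mk z, (Submodule.Quotient.eq _).2 ?_⟩
    have : ((P.complex.d 2 1).app T).hom z - x = -y := by
      rw [show ((P.complex.d 2 1).app T).hom z = x - y from hz]
      abel
    rw [this]
    exact neg_mem hy

lemma extendsUniquely_iff_isZero (W : FIMod.{u, v}) (T : FI.{u}) :
    W.ExtendsUniquely T (· < T.card) ↔
      IsZero ((H0.obj W).obj T) ∧ IsZero (((H 1).obj W).obj T) := by
  let P := projectiveResolution W
  let p : P.complex.X 0 ⟶ W := P.π.f 0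
  have : Epi p := inferInstanceAs (Epi (P.π.f 0))
  have hp (S : FI.{u}) : Function.Surjective (p.app S).hom :=
    (ModuleCat.epi_iff_surjective _).1 inferInstance
  rw [isZero_H0_obj_iff, isZero_H1_obj_iff_ker_inf_decomposables_le P p
    P.complex_d_comp_π_f_zero P.exact₀]
  exact ⟨fun H => ⟨decomposables_eq_top_of_extendsUniquely H,
      ker_inf_decomposables_le_of_extendsUniquely p hp H⟩,
    fun H => extendsUniquely_of_ker_inf_decomposables_le p hp H.1 H.2⟩

/-- The colimit property for subsets of at most `N` elements, in terms of homology. -/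
lemma forall_isColimitOfSmallSubsets_iff (W : FIMod.{u, v}) (N : WithBot ℕ∞) :
    (∀ T : FI.{u}, W.IsColimitOfSmallSubsets T N) ↔
      max (deg (H0.obj W)) (deg ((H 1).obj W)) ≤ N := by
  simp only [isColimitOfSmallSubsets_iff]
  rw [forall_extendsUniquely_iff W _ fun m n hmn hn => le_trans (by exact_mod_cast hmn) hn,
    max_le_iff, deg_le_iff, deg_le_iff]
  simp only [extendsUniquely_iff_isZero]
  exact ⟨fun H => ⟨fun T hT => (H T hT).1, fun T hT => (H T hT).2⟩,
    fun H T hT => ⟨H.1 T hT, H.2 T hT⟩⟩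

end FIMod

theorem theoremC (W : FIMod.{u, v}) (N : WithBot ℕ∞)
    (hN : N = max (FIMod.deg (FIMod.H0.obj W)) (FIMod.deg ((FIMod.H 1).obj W))) :
    (∀ T : FI.{u}, W.IsColimitOfSmallSubsets T N) ∧
      ∀ K : WithBot ℕ∞, (∀ T : FI.{u}, W.IsColimitOfSmallSubsets T K) → N ≤ K :=
  ⟨(W.forall_isColimitOfSmallSubsets_iff N).2 hN.ge,
    fun K hK => hN.trans_le ((W.forall_isColimitOfSmallSubsets_iff K).1 hK)⟩
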